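/- Let $K$ be a commutative ring, let $A$ be a unital associative, not necessarily commutative, $K$-algebra in which every positive integer is invertible (i.e. $A$ is also a $\mathbb{Q}$-algebra), and let $A=A_0\supseteq A_1\supseteq A_2\supseteq\cdots$ be non-unital $K$-subalgebras with $A_mA_n\subseteq A_{m+n}$ for all $m,n\ge 0$ and $\bigcap_n A_n=\{0\}$, such that $A$ is complete for the metric $d(x,y)=\inf\{2^{-n} : x-y\in A_n\}$. Let $R:A\to A$ be a $K$-linear map with $R(A_n)\subseteq A_n$ for all $n\ge 0$ which is a Rota-Baxter operator of weight $0$: $R(x)R(y)=R(xR(y))+R(R(x)y)$ for all $x,y\in A$. All infinite series below are taken in the metric $d$; write $\exp(x)=\sum_{n\ge 0}x^n/n!$ for $x\in A_1$ and $\operatorname{ad}_x(y)=xy-yx$. Then: (i) For every $a\in A_1$ there is a unique $\chi_0(a)\in A_1$ with $$\chi_0(a)=\frac{\operatorname{ad}_{R(\chi_0(a))}}{\exp(\operatorname{ad}_{R(\chi_0(a))})-1}(a)=\sum_{k\ge 0}\frac{B_k}{k!}\bigl(\operatorname{ad}_{R(\chi_0(a))}\bigr)^k(a),$$ where $B_k$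 are the Bernoulli numbers ($B_0=1$, $B_1=-\tfrac12$). (ii) For all $a_0,a_1\in A_1$, the equation $b=R(a_0)+R(a_1b)$ has a unique solution $b\in A$, namely $$b=\exp\bigl(R(\chi_0(a_1))\bigr)\,R\bigl(\exp\bigl(-R(\chi_0(a_1))\bigr)a_0\bigr).$$ (iii) For all $a_0,a_1\in A_1$, the series on the left converges and $$\sum_{n=0}^\infty \underbrace{R(a_1\cdots R(a_1}_{n}R(a_0))\cdots)=\exp\bigl(R(\chi_0(a_1))\bigr)\,R\bigl(\exp\bigl(-R(\chi_0(a_1))\bigr)a_0\bigr).$$ -/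

import Mathlib

open Filter Topology

/-- A filtration `A = A₀ ⊇ A₁ ⊇ A₂ ⊇ ⋯` of a (unital, associative, not necessarily commutative)
`K`-algebra `A` by non-unital subalgebras, separated and multiplicative. -/
structure AlgFiltration (K A : Type*) [CommRing K] [Ring A] [Algebra K A] where
  /-- The `n`-th piece of the filtration. -/
  piece : ℕ → NonUnitalSubalgebra K A
  piece_zero : piece 0 = ⊤
  piece_succ_le : ∀ n, piece (n + 1) ≤ piece n
  eq_zero_of_forall_mem : ∀ x : A, (∀ n, x ∈ piece n) → x = 0
  mul_mem_piece : ∀ m n, ∀ x ∈ piece m, ∀ y ∈ piece n, x * y ∈ piece (m + n)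

/-- `R` is a Rota-Baxter operator of weight `w` on `A`. -/
def IsRotaBaxterOperator {K A : Type*} [CommRing K] [Ring A] [Algebra K A]
    (w : K) (R : A →ₗ[K] A) : Prop :=
  ∀ x y : A, R x * R y = R (x * R y) + R (R x * y) + w • R (x * y)

namespace AlgFiltration

section Basic

variable {K A : Type*} [CommRing K] [Ring A] [Algebra K A] (F : AlgFiltration K A)

/-- `d(x, y) = inf {2⁻ⁿ | x - y ∈ Aₙ}`. -/
noncomputable def fdist (x y : A) : ℝ :=
  sInf {r : ℝ | ∃ n : ℕ, x - y ∈ F.piece n ∧ r = (2 : ℝ)⁻¹ ^ n}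

theorem piece_antitone : Antitone F.piece := antitone_nat_of_succ_le F.piece_succ_le

theorem fdist_set_nonempty (x y : A) :
    {r : ℝ | ∃ n : ℕ, x - y ∈ F.piece n ∧ r = (2 : ℝ)⁻¹ ^ n}.Nonempty :=
  ⟨1, 0, by rw [F.piece_zero]; trivial, by simp⟩

theorem fdist_set_bddBelow (x y : A) :
    BddBelow {r : ℝ | ∃ n : ℕ, x - y ∈ F.piece n ∧ r = (2 : ℝ)⁻¹ ^ n} :=
  ⟨0, by rintro r ⟨n, -, rfl⟩; positivity⟩

theorem fdist_nonneg (x y : A) : 0 ≤ F.fdist x y :=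
  le_csInf (F.fdist_set_nonempty x y) (by rintro r ⟨n, -, rfl⟩; positivity)

theorem fdist_le_iff (x y : A) (n : ℕ) : F.fdist x y ≤ (2 : ℝ)⁻¹ ^ n ↔ x - y ∈ F.piece n := by
  constructor
  · intro h
    by_contra hn
    cases n with
    | zero => exact hn (by rw [F.piece_zero]; trivial)
    | succ k =>
      have h1 : (2 : ℝ)⁻¹ ^ k ≤ F.fdist x y := by
        refine le_csInf (F.fdist_set_nonempty x y) ?_
        rintro r ⟨m, hm, rfl⟩
        have hmk : m ≤ k := by
          by_contra hlt
          exact hn (F.piece_antitone (by omega) hm)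
        exact pow_le_pow_of_le_one (by norm_num) (by norm_num) hmk
      have h2 : (0 : ℝ) < (2 : ℝ)⁻¹ ^ k := by positivity
      rw [pow_succ] at h
      linarith
  · intro h
    exact csInf_le (F.fdist_set_bddBelow x y) ⟨n, h, rfl⟩

theorem fdist_self (x : A) : F.fdist x x = 0 := by
  refine le_antisymm ?_ (F.fdist_nonneg x x)
  refine ge_of_tendsto' (tendsto_pow_atTop_nhds_zero_of_lt_one (r := (2 : ℝ)⁻¹)
    (by norm_num) (by norm_num)) fun n => ?_
  rw [fdist_le_iff, sub_self]
  exact zero_mem _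

theorem fdist_comm (x y : A) : F.fdist x y = F.fdist y x := by
  unfold fdist
  congr 1
  ext r
  constructor <;> rintro ⟨n, hn, rfl⟩ <;> refine ⟨n, ?_, rfl⟩ <;> rw [← neg_sub] <;>
    exact neg_mem hn

theorem fdist_triangle (x y z : A) : F.fdist x z ≤ F.fdist x y + F.fdist y z := by
  have key : ∀ m n : ℕ, x - y ∈ F.piece m → y - z ∈ F.piece n →
      F.fdist x z ≤ (2 : ℝ)⁻¹ ^ m + (2 : ℝ)⁻¹ ^ n := by
    intro m n hm hn
    have hmin : F.fdist x z ≤ (2 : ℝ)⁻¹ ^ (min m n) := by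
      rw [fdist_le_iff, ← sub_add_sub_cancel x y z]
      exact add_mem (F.piece_antitone (min_le_left m n) hm)
        (F.piece_antitone (min_le_right m n) hn)
    have h1 : (0 : ℝ) < (2 : ℝ)⁻¹ ^ m := by positivity
    have h2 : (0 : ℝ) < (2 : ℝ)⁻¹ ^ n := by positivity
    rcases min_choice m n with h | h <;> rw [h] at hmin <;> linarith
  rw [← sub_le_iff_le_add]
  refine le_csInf (F.fdist_set_nonempty x y) ?_
  rintro r ⟨m, hm, rfl⟩
  rw [sub_le_iff_le_add, ← sub_le_iff_le_add']
  refine le_csInf (F.fdist_set_nonempty y z) ?_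
  rintro r ⟨n, hn, rfl⟩
  rw [sub_le_iff_le_add']
  exact key m n hm hn

theorem eq_of_fdist_eq_zero {x y : A} (h : F.fdist x y = 0) : x = y := by
  refine sub_eq_zero.1 (F.eq_zero_of_forall_mem _ fun n => ?_)
  rw [← fdist_le_iff, h]
  positivity

/-- The metric space structure on `A` given by the distance of the filtration. -/
@[reducible]
noncomputable def metricSpace : MetricSpace A where
  dist := F.fdist
  dist_self := F.fdist_self
  dist_comm := F.fdist_comm
  dist_triangle := F.fdist_triangle
  eq_of_dist_eq_zero := F.eq_of_fdist_eq_zero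

/-- The filtration metric is complete. -/
def IsComplete : Prop :=
  @CompleteSpace A F.metricSpace.toPseudoMetricSpace.toUniformSpace

/-- The series `∑ₙ uₙ` converges to `s` in the filtration metric. -/
def HasSeriesSum (u : ℕ → A) (s : A) : Prop :=
  Tendsto (fun N => F.fdist (∑ i ∈ Finset.range N, u i) s) atTop (𝓝 0)

open Classical in
/-- The sum `∑ₙ uₙ` of a series converging in the filtration metric (`0` if it diverges). -/
noncomputable def seriesSum (u : ℕ → A) : A :=
  if h : ∃ s, F.HasSeriesSum u s then h.choose else 0

/-- In a complete filtered algebra a series with `uₙ ∈ Aₙ` converges. -/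
theorem hasSeriesSum_seriesSum (hF : F.IsComplete) (u : ℕ → A) (hu : ∀ n, u n ∈ F.piece n) :
    F.HasSeriesSum u (F.seriesSum u) := by
  have hex : ∃ s, F.HasSeriesSum u s := by
    letI := F.metricSpace
    haveI : CompleteSpace A := hF
    have hc : CauchySeq fun N => ∑ i ∈ Finset.range N, u i := by
      refine cauchySeq_of_le_geometric (2 : ℝ)⁻¹ 1 (by norm_num) fun n => ?_
      rw [one_mul]
      refine (F.fdist_le_iff _ _ n).2 ?_
      rw [Finset.sum_range_succ, sub_add_cancel_left]
      exact neg_mem (hu n)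
    obtain ⟨s, hs⟩ := cauchySeq_tendsto_of_complete hc
    exact ⟨s, tendsto_iff_dist_tendsto_zero.1 hs⟩
  unfold seriesSum
  rw [dif_pos hex]
  exact hex.choose_spec

/-- The sum of a convergent series is unique. -/
theorem HasSeriesSum.unique {F : AlgFiltration K A} {u : ℕ → A} {s t : A}
    (hs : F.HasSeriesSum u s) (ht : F.HasSeriesSum u t) : s = t := by
  letI := F.metricSpace
  exact tendsto_nhds_unique (tendsto_iff_dist_tendsto_zero.2 hs)
    (tendsto_iff_dist_tendsto_zero.2 ht)

/-- `(A, Aₙ, R)` is a complete filtered Rota-Baxter algebra of weight `w`. -/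
structure IsCompleteRotaBaxter (w : K) (R : A →ₗ[K] A) : Prop where
  isComplete : F.IsComplete
  isRotaBaxter : IsRotaBaxterOperator w R
  map_mem : ∀ n, ∀ x ∈ F.piece n, R x ∈ F.piece n

end Basic

section Rational

variable {K A : Type*} [CommRing K] [Ring A] [Algebra K A] [Algebra ℚ A] (F : AlgFiltration K A)

/-- `exp x = ∑ₙ xⁿ / n!`. -/
noncomputable def fexp (x : A) : A :=
  F.seriesSum fun n => ((n.factorial : ℚ)⁻¹) • x ^ n

/-- `(ad x / (exp (ad x) - 1)) a = ∑ₖ (Bₖ / k!) (ad x)ᵏ a`, where `ad x y = x y - y x` and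
`Bₖ` are the Bernoulli numbers (`B₀ = 1`, `B₁ = -1/2`). -/
noncomputable def adDivExpSubOne (x a : A) : A :=
  F.seriesSum fun k => (bernoulli k / (k.factorial : ℚ)) • (fun y : A => x * y - y * x)^[k] a

/-- `c ∈ A₁` solves the zero BCH-recursion `c = (ad (R c) / (exp (ad (R c)) - 1)) a`. -/
def IsZeroBCHSolution (R : A →ₗ[K] A) (a c : A) : Prop :=
  c ∈ F.piece 1 ∧ c = F.adDivExpSubOne (R c) a

open Classical in
/-- The zero BCH-recursion operator `χ₀`: the solution in `A₁` of the zero BCH-recursion. -/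
noncomputable def zeroBCH (R : A →ₗ[K] A) (a : A) : A :=
  if h : ∃ c, F.IsZeroBCHSolution R a c then h.choose else 0

end Rational

end AlgFiltration

/-!
Everything rests on one identity: if `c` solves the zero BCH-recursion for `a` and `x = R c`, then
`exp x = 1 + R (a * exp x)` (`fexp_eq_one_add`).

* The Rota-Baxter relation of weight zero gives, by induction on `n`,
  `xⁿ = R (∑_{i+j=n-1} xⁱ c xʲ)` (`IsRotaBaxterOperator.map_powDeriv`): the argument of `R` is the
  derivative of `y ↦ yⁿ` at `x` in the direction `c`.
* Moving all powers of `x` to the right turns this derivative into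
  `∑ₖ (n choose k+1) (ad x)ᵏ(c) xⁿ⁻¹⁻ᵏ` (`powDeriv_eq_sum`), so that `exp x - 1` is `R` applied to
  `(∑ₖ (ad x)ᵏ(c) / (k+1)!) * exp x`, a Cauchy product.
* Since `∑ (Bₖ / k!) tᵏ` and `∑ tᵏ / (k+1)!` are inverse power series, the recursion
  `c = ∑ (Bₖ / k!) (ad x)ᵏ a` says that the first factor is `a` (`hasSeriesSum_adIter`).

Given the identity, one application of the Rota-Baxter relation to
`R (a₁ * exp x) * R (exp (-x) * a₀)` shows that `b = exp x * R (exp (-x) * a₀)` satisfies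
`b = R a₀ + R (a₁ * b)`. Existence and uniqueness of `χ₀`, uniqueness of `b` and convergence of the
iterated series all hold because the maps in question send elements congruent modulo `Aₙ` to
elements congruent modulo `Aₙ₊₁`.

Infinite series are handled through congruences: for `uₙ ∈ Aₙ`, the series `∑ uₙ` has sum `s` if and
only if `s - ∑_{n<N} uₙ ∈ A_N` for all `N`.
-/

open Finset

namespace AlgFiltration

/-! ### Congruences modulo the filtration -/

section Series

variable {K A : Type*} [CommRing K] [Ring A] [Algebra K A] {F : AlgFiltration K A}

theorem mem_piece_zero (x : A) : x ∈ F.piece 0 := by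
  rw [F.piece_zero]; trivial

theorem mul_mem_piece_right {n : ℕ} (x : A) {y : A} (hy : y ∈ F.piece n) :
    x * y ∈ F.piece n := by
  simpa using F.mul_mem_piece 0 n x (mem_piece_zero x) y hy

theorem mul_mem_piece_left {n : ℕ} {x : A} (y : A) (hx : x ∈ F.piece n) :
    x * y ∈ F.piece n := by
  simpa using F.mul_mem_piece n 0 x hx y (mem_piece_zero y)

theorem pow_mem_piece {x : A} (hx : x ∈ F.piece 1) (n : ℕ) : x ^ n ∈ F.piece n := by
  induction n with
  | zero => exact mem_piece_zero _
  | succ n ih => rw [pow_succ]; exact F.mul_mem_piece n 1 _ ih _ hx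

/-- The pieces are two-sided ideals because `A₀ = A`; hence they are stable under rational scalars,
although they are only assumed to be `K`-submodules. -/
theorem rat_smul_mem_piece [Algebra ℚ A] {n : ℕ} (q : ℚ) {x : A} (hx : x ∈ F.piece n) :
    q • x ∈ F.piece n := by
  rw [Algebra.smul_def]
  exact mul_mem_piece_right _ hx

theorem eq_of_forall_sub_mem {x y : A} (h : ∀ n, x - y ∈ F.piece n) : x = y :=
  sub_eq_zero.1 (F.eq_zero_of_forall_mem _ h)

theorem sub_mem_of_sub_mem {n : ℕ} {x y z : A} (h : x - y ∈ F.piece n) (h' : y - z ∈ F.piece n) :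
    x - z ∈ F.piece n := by
  simpa using add_mem h h'

theorem mul_sub_mul_mem {n : ℕ} {x x' y y' : A} (hx : x - x' ∈ F.piece n)
    (hy : y - y' ∈ F.piece n) : x * y - x' * y' ∈ F.piece n := by
  have : x * y - x' * y' = (x - x') * y + x' * (y - y') := by noncomm_ring
  rw [this]
  exact add_mem (mul_mem_piece_left _ hx) (mul_mem_piece_right _ hy)

theorem hasSeriesSum_of_sub_mem {u : ℕ → A} {s : A}
    (h : ∀ N, s - ∑ i ∈ range N, u i ∈ F.piece N) : F.HasSeriesSum u s := by
  refine squeeze_zero (fun N => F.fdist_nonneg _ _) (fun N => ?_)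
    (tendsto_pow_atTop_nhds_zero_of_lt_one (r := (2 : ℝ)⁻¹) (by norm_num) (by norm_num))
  rw [F.fdist_comm, fdist_le_iff]
  exact h N

theorem HasSeriesSum.sub_mem {u : ℕ → A} {s : A} (hs : F.HasSeriesSum u s)
    (hu : ∀ n, u n ∈ F.piece n) (N : ℕ) : s - ∑ i ∈ range N, u i ∈ F.piece N := by
  have hpos : (0 : ℝ) < (2 : ℝ)⁻¹ ^ N := by positivity
  obtain ⟨M, hNM, hM⟩ := (((hs.eventually_lt_const hpos).and (eventually_ge_atTop N)).exists).imp
    fun M h => And.symm h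
  rw [← sub_add_sub_cancel s (∑ i ∈ range M, u i)]
  refine add_mem ?_ ?_
  · rw [← fdist_le_iff, F.fdist_comm]
    exact hM.le
  · rw [← sum_Ico_eq_sub _ hNM]
    exact sum_mem fun i hi => F.piece_antitone (mem_Ico.1 hi).1 (hu i)

theorem IsComplete.sub_mem (hF : F.IsComplete) {u : ℕ → A} (hu : ∀ n, u n ∈ F.piece n) (N : ℕ) :
    F.seriesSum u - ∑ i ∈ range N, u i ∈ F.piece N :=
  (F.hasSeriesSum_seriesSum hF u hu).sub_mem hu N

/-- Modulo `A_N`, the square and the triangular partial sums of a double series with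
`w j k ∈ A_{j+k}` agree. -/
theorem sum_square_sub_sum_antidiagonal_mem {w : ℕ → ℕ → A} (hw : ∀ j k, w j k ∈ F.piece (j + k))
    (N : ℕ) : ∑ j ∈ range N, ∑ k ∈ range N, w j k -
      ∑ n ∈ range N, ∑ p ∈ antidiagonal n, w p.1 p.2 ∈ F.piece N := by
  have h1 : ∑ n ∈ range N, ∑ p ∈ antidiagonal n, w p.1 p.2 =
      ∑ p ∈ range N ×ˢ range N with p.1 + p.2 < N, w p.1 p.2 := by
    rw [← sum_fiberwise_of_maps_to (t := range N) (g := fun p : ℕ × ℕ => p.1 + p.2)]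
    · refine sum_congr rfl fun n hn => sum_congr ?_ fun _ _ => rfl
      ext ⟨i, j⟩
      simp only [HasAntidiagonal.mem_antidiagonal, mem_filter, mem_product, mem_range] at hn ⊢
      omega
    · intro p hp
      simpa using (mem_filter.1 hp).2
  rw [h1, ← sum_product', ← sum_filter_add_sum_filter_not _ (fun p : ℕ × ℕ => p.1 + p.2 < N),
    add_sub_cancel_left]
  exact sum_mem fun p hp => F.piece_antitone (not_lt.1 (mem_filter.1 hp).2) (hw _ _)

/-- The Cauchy product of two series. -/
theorem HasSeriesSum.mul {u v : ℕ → A} {s t : A} (hs : F.HasSeriesSum u s)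
    (ht : F.HasSeriesSum v t) (hu : ∀ n, u n ∈ F.piece n) (hv : ∀ n, v n ∈ F.piece n) :
    F.HasSeriesSum (fun n => ∑ p ∈ antidiagonal n, u p.1 * v p.2) (s * t) := by
  refine hasSeriesSum_of_sub_mem fun N => ?_
  refine sub_mem_of_sub_mem (mul_sub_mul_mem (hs.sub_mem hu N) (ht.sub_mem hv N)) ?_
  rw [sum_mul_sum]
  exact sum_square_sub_sum_antidiagonal_mem
    (fun j k => F.mul_mem_piece j k _ (hu j) _ (hv k)) N

/-- A self-map of `A₁` that improves congruences by one step of the filtration has a unique fixed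
point in `A₁`. -/
theorem IsComplete.existsUnique_fixedPoint (hF : F.IsComplete) {Φ : A → A}
    (hmem : ∀ c ∈ F.piece 1, Φ c ∈ F.piece 1)
    (hΦ : ∀ n, ∀ c ∈ F.piece 1, ∀ c' ∈ F.piece 1, c - c' ∈ F.piece n →
      Φ c - Φ c' ∈ F.piece (n + 1)) :
    ∃! c, c ∈ F.piece 1 ∧ c = Φ c := by
  have hit : ∀ n, Φ^[n] 0 ∈ F.piece 1 := fun n => by
    induction n with
    | zero => exact zero_mem _
    | succ n ih => rw [Function.iterate_succ_apply']; exact hmem _ ih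
  have hstep : ∀ n, Φ^[n + 1] 0 - Φ^[n] 0 ∈ F.piece n := fun n => by
    induction n with
    | zero => exact mem_piece_zero _
    | succ n ih =>
      have h := hΦ _ _ (hit _) _ (hit _) ih
      rwa [← Function.iterate_succ_apply' Φ, ← Function.iterate_succ_apply' Φ] at h
  obtain ⟨c, hc⟩ : ∃ c, ∀ N, c - Φ^[N] 0 ∈ F.piece N := ⟨_, fun N => by
    have := hF.sub_mem hstep N
    rwa [sum_range_sub (fun n => Φ^[n] 0), Function.iterate_zero_apply, sub_zero] at this⟩
  have hc1 : c ∈ F.piece 1 := by simpa using add_mem (hc 1) (hit 1)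
  have hcΦ : c = Φ c := by
    refine eq_of_forall_sub_mem (F := F) fun N => ?_
    refine F.piece_antitone N.le_succ (sub_mem_of_sub_mem (hc (N + 1)) ?_)
    rw [Function.iterate_succ_apply', ← neg_sub]
    exact neg_mem (hΦ _ _ hc1 _ (hit _) (hc N))
  refine ⟨c, ⟨hc1, hcΦ⟩, fun d hd => eq_of_forall_sub_mem (F := F) fun N => ?_⟩
  induction N with
  | zero => exact mem_piece_zero _
  | succ N ih =>
    rw [hd.2, hcΦ]
    exact hΦ _ _ hd.1 _ hc1 ih

end Series

/-! ### The adjoint action and the derivative of a power -/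

section Ad

variable {A : Type*} [Ring A]

/-- The commutator map `ad x : y ↦ x * y - y * x`, as an additive endomorphism. -/
def adHom (x : A) : AddMonoid.End A :=
  AddMonoidHom.mulLeft x - AddMonoidHom.mulRight x

theorem adHom_apply (x y : A) : adHom x y = x * y - y * x := rfl

/-- The derivative `∑_{i+j=n-1} xⁱ c xʲ` of `y ↦ yⁿ` at `x` in the direction `c`, defined through
the Leibniz rule. -/
def powDeriv (x c : A) : ℕ → A
  | 0 => 0
  | n + 1 => c * x ^ n + x * powDeriv x c n

/-- Right multiplication by `x` commutes with `ad x` and left multiplication is their sum, so this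
is the binomial expansion of `((D + r)ⁿ⁺¹ - rⁿ⁺¹) / D` with `D = ad x` and `r` right
multiplication by `x`. -/
theorem powDeriv_eq_sum (x c : A) (n : ℕ) :
    powDeriv x c (n + 1) =
      ∑ p ∈ antidiagonal n, (n + 1).choose (p.1 + 1) • ((adHom x)^[p.1] c * x ^ p.2) := by
  induction n with
  | zero => simp [powDeriv]
  | succ n ih =>
    have hmul : ∀ p : ℕ × ℕ, x * ((adHom x)^[p.1] c * x ^ p.2) =
        (adHom x)^[p.1 + 1] c * x ^ p.2 + (adHom x)^[p.1] c * x ^ (p.2 + 1) := fun p => by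
      rw [Function.iterate_succ_apply', adHom_apply, pow_succ' x p.2]
      noncomm_ring
    rw [powDeriv, ih, mul_sum]
    simp only [mul_smul_comm, hmul, smul_add, sum_add_distrib]
    -- Pascal's rule splits the right-hand side into the two sums produced by `hmul`; the boundary
    -- terms are `c * x ^ (n + 1)` and `(n + 1).choose (n + 2) = 0`.
    simp only [Nat.choose_succ_succ' (n + 1), add_smul, sum_add_distrib]
    rw [Nat.sum_antidiagonal_succ, Nat.sum_antidiagonal_succ'
      (f := fun p => (n + 1).choose (p.1 + 1) • ((adHom x)^[p.1] c * x ^ p.2))]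
    simp [add_assoc]

theorem _root_.IsRotaBaxterOperator.map_powDeriv {K : Type*} [CommRing K] [Algebra K A]
    {R : A →ₗ[K] A} (hR : IsRotaBaxterOperator (0 : K) R) (c : A) (n : ℕ) :
    R (powDeriv (R c) c (n + 1)) = R c ^ (n + 1) := by
  induction n with
  | zero => simp [powDeriv]
  | succ n ih =>
    rw [powDeriv, map_add, pow_succ' _ (n + 1), ← ih, hR, zero_smul, add_zero]

variable {K : Type*} [CommRing K] [Algebra K A] {F : AlgFiltration K A}

theorem adHom_mem {x y : A} (hx : x ∈ F.piece 1) {n : ℕ} (hy : y ∈ F.piece n) :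
    adHom x y ∈ F.piece (n + 1) := by
  refine sub_mem ?_ (F.mul_mem_piece n 1 _ hy _ hx)
  rw [add_comm]
  exact F.mul_mem_piece 1 n _ hx _ hy

theorem adHom_iterate_mem {x y : A} (hx : x ∈ F.piece 1) {m : ℕ} (hy : y ∈ F.piece m) (n : ℕ) :
    (adHom x)^[n] y ∈ F.piece (n + m) := by
  induction n with
  | zero => simpa using hy
  | succ n ih =>
    rw [Function.iterate_succ_apply', Nat.add_right_comm]
    exact adHom_mem hx ih

theorem adHom_iterate_mem_self {x : A} (hx : x ∈ F.piece 1) (y : A) (n : ℕ) :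
    (adHom x)^[n] y ∈ F.piece n :=
  adHom_iterate_mem hx (m := 0) (mem_piece_zero y) n

/-- Replacing `x` by an element congruent to it modulo `Aₙ` changes `(ad x)ᵏ a` by an element of
`Aₙ₊₁`, because `a ∈ A₁`. -/
theorem adHom_iterate_sub_mem {x x' a : A} {n : ℕ} (hx : x - x' ∈ F.piece n)
    (ha : a ∈ F.piece 1) (k : ℕ) :
    (adHom x)^[k] a - (adHom x')^[k] a ∈ F.piece (n + 1) ∧ (adHom x')^[k] a ∈ F.piece 1 := by
  induction k with
  | zero => exact ⟨by simp, ha⟩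
  | succ k ih =>
    obtain ⟨ih1, ih2⟩ := ih
    rw [Function.iterate_succ_apply', Function.iterate_succ_apply']
    set y := (adHom x)^[k] a
    set y' := (adHom x')^[k] a
    have h : adHom x y - adHom x' y' =
        (x * (y - y') - (y - y') * x) + ((x - x') * y' - y' * (x - x')) := by
      simp only [adHom_apply]; noncomm_ring
    refine ⟨?_, sub_mem (mul_mem_piece_right _ ih2) (mul_mem_piece_left _ ih2)⟩
    rw [h]
    refine add_mem (sub_mem (mul_mem_piece_right _ ih1) (mul_mem_piece_left _ ih1))
      (sub_mem (F.mul_mem_piece n 1 _ hx _ ih2) ?_)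
    rw [add_comm]
    exact F.mul_mem_piece 1 n _ ih2 _ hx

end Ad

/-! ### Exponentials and the zero BCH-recursion -/

section Rational

variable {K A : Type*} [CommRing K] [Ring A] [Algebra K A] [Algebra ℚ A] {F : AlgFiltration K A}

theorem expTerm_mem {x : A} (hx : x ∈ F.piece 1) (n : ℕ) :
    ((n.factorial : ℚ)⁻¹) • x ^ n ∈ F.piece n :=
  rat_smul_mem_piece _ (pow_mem_piece hx n)

theorem hasSeriesSum_fexp (hF : F.IsComplete) {x : A} (hx : x ∈ F.piece 1) :
    F.HasSeriesSum (fun n => ((n.factorial : ℚ)⁻¹) • x ^ n) (F.fexp x) :=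
  F.hasSeriesSum_seriesSum hF _ (expTerm_mem hx)

theorem fexp_mul_fexp_neg (hF : F.IsComplete) {x : A} (hx : x ∈ F.piece 1) :
    F.fexp x * F.fexp (-x) = 1 := by
  refine HasSeriesSum.unique ((hasSeriesSum_fexp hF hx).mul (hasSeriesSum_fexp hF (neg_mem hx))
    (expTerm_mem hx) (expTerm_mem (neg_mem hx))) (hasSeriesSum_of_sub_mem fun N => ?_)
  have hcoeff : ∀ n, ∑ p ∈ antidiagonal n,
      (((p.1.factorial : ℚ)⁻¹) • x ^ p.1) * (((p.2.factorial : ℚ)⁻¹) • (-x) ^ p.2) =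
      if n = 0 then 1 else 0 := fun n => by
    have h := congrArg (PowerSeries.coeff n) (PowerSeries.exp_mul_exp_neg_eq_one (A := ℚ))
    rw [PowerSeries.coeff_mul, PowerSeries.coeff_one] at h
    have h2 := congrArg (fun q : ℚ => q • x ^ n) h
    simp only [sum_smul, ite_smul, one_smul, zero_smul] at h2
    trans if n = 0 then x ^ n else 0
    · rw [← h2]
      refine sum_congr rfl fun p hp => ?_
      rw [← mem_antidiagonal.1 hp, neg_pow x, pow_add, smul_mul_smul_comm]
      rcases Nat.even_or_odd p.2 with h | h <;>
        simp [PowerSeries.coeff_exp, PowerSeries.evalNegHom, h.neg_one_pow]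
    · split_ifs with h <;> simp [h]
  rw [sum_congr rfl fun n _ => hcoeff n]
  cases N with
  | zero => exact mem_piece_zero _
  | succ N => simp

theorem adDivTerm_mem {x : A} (hx : x ∈ F.piece 1) (a : A) (k : ℕ) :
    (bernoulli k / (k.factorial : ℚ)) • (adHom x)^[k] a ∈ F.piece k :=
  rat_smul_mem_piece _ (adHom_iterate_mem_self hx a k)

theorem hasSeriesSum_adDivExpSubOne (hF : F.IsComplete) {x : A} (hx : x ∈ F.piece 1) (a : A) :
    F.HasSeriesSum (fun k => (bernoulli k / (k.factorial : ℚ)) • (adHom x)^[k] a)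
      (F.adDivExpSubOne x a) :=
  F.hasSeriesSum_seriesSum hF _ (adDivTerm_mem hx a)

theorem existsUnique_isZeroBCHSolution (hF : F.IsComplete) {R : A →ₗ[K] A}
    (hR : ∀ n, ∀ x ∈ F.piece n, R x ∈ F.piece n) {a : A} (ha : a ∈ F.piece 1) :
    ∃! c, F.IsZeroBCHSolution R a c := by
  refine hF.existsUnique_fixedPoint (Φ := fun c => F.adDivExpSubOne (R c) a) (fun c hc => ?_)
    fun n c hc c' hc' hcc => ?_
  · have h := (hasSeriesSum_adDivExpSubOne hF (hR 1 c hc) a).sub_mem (adDivTerm_mem (hR 1 c hc) a) 1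
    simpa using add_mem h ha
  · have h := fun c hc => (hasSeriesSum_adDivExpSubOne hF (hR 1 c hc) a).sub_mem
      (adDivTerm_mem (hR 1 c hc) a) (n + 1)
    refine sub_mem_of_sub_mem (h c hc) (sub_mem_of_sub_mem ?_
      (by rw [← neg_sub]; exact neg_mem (h c' hc')))
    rw [← sum_sub_distrib]
    refine sum_mem fun k _ => ?_
    rw [← smul_sub]
    refine rat_smul_mem_piece _ (adHom_iterate_sub_mem ?_ ha k).1
    rw [← map_sub]
    exact hR n _ hcc

theorem isZeroBCHSolution_zeroBCH (hF : F.IsComplete) {R : A →ₗ[K] A}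
    (hR : ∀ n, ∀ x ∈ F.piece n, R x ∈ F.piece n) {a : A} (ha : a ∈ F.piece 1) :
    F.IsZeroBCHSolution R a (F.zeroBCH R a) := by
  have h := (existsUnique_isZeroBCHSolution hF hR ha).exists
  unfold zeroBCH
  rw [dif_pos h]
  exact h.choose_spec

/-- The coefficients of `∑ tʲ / (j+1)!` and `∑ (Bₖ / k!) tᵏ` are those of inverse power series. -/
theorem sum_antidiagonal_bernoulli_div_factorial (n : ℕ) :
    ∑ p ∈ antidiagonal n, (((p.1 + 1).factorial : ℚ)⁻¹ * (bernoulli p.2 / (p.2.factorial : ℚ))) =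
      if n = 0 then 1 else 0 := by
  have h := congrArg (PowerSeries.coeff (n + 1)) (bernoulliPowerSeries_mul_exp_sub_one ℚ)
  rw [mul_comm, PowerSeries.coeff_mul, Nat.sum_antidiagonal_succ, PowerSeries.coeff_X] at h
  simpa [bernoulliPowerSeries, PowerSeries.coeff_exp, PowerSeries.coeff_one] using h

/-- The series `(exp (ad x) - 1) / ad x` inverts `ad x / (exp (ad x) - 1)`. -/
theorem hasSeriesSum_adIter (hF : F.IsComplete) {x : A} (hx : x ∈ F.piece 1) (a : A) :
    F.HasSeriesSum (fun k => (((k + 1).factorial : ℚ)⁻¹) • (adHom x)^[k] (F.adDivExpSubOne x a))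
      a := by
  set c := F.adDivExpSubOne x a
  refine hasSeriesSum_of_sub_mem fun N => ?_
  rw [← neg_sub]
  refine neg_mem ?_
  have hcN := (hasSeriesSum_adDivExpSubOne hF hx a).sub_mem (adDivTerm_mem hx a) N
  have hlin : ∀ (q : ℚ) (k : ℕ) (y : A), (adHom x)^[k] (q • y) = q • (adHom x)^[k] y := by
    intro q k y
    induction k with
    | zero => rfl
    | succ k ih =>
      rw [Function.iterate_succ_apply', ih, Function.iterate_succ_apply', map_rat_smul]
  have hpow : ∀ j, (adHom x)^[j] = ⇑(adHom x ^ j) :=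
    fun j => (AddMonoid.End.coe_pow A (adHom x) j).symm
  have h1 : ∀ j, (adHom x)^[j] c - ∑ k ∈ range N,
      (bernoulli k / (k.factorial : ℚ)) • (adHom x)^[j + k] a ∈ F.piece N := fun j => by
    have := F.piece_antitone (Nat.le_add_left N j) (adHom_iterate_mem hx hcN j)
    rw [hpow j, map_sub, map_sum, ← hpow j] at this
    simpa only [hlin, ← Function.iterate_add_apply] using this
  refine sub_mem_of_sub_mem (y := ∑ j ∈ range N, ∑ k ∈ range N,
    (((j + 1).factorial : ℚ)⁻¹ * (bernoulli k / (k.factorial : ℚ))) • (adHom x)^[j + k] a) ?_ ?_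
  · rw [← sum_sub_distrib]
    refine sum_mem fun j _ => ?_
    simp only [mul_smul]
    rw [← smul_sum, ← smul_sub]
    exact rat_smul_mem_piece _ (h1 j)
  · refine sub_mem_of_sub_mem (sum_square_sub_sum_antidiagonal_mem
      (fun j k => rat_smul_mem_piece _ (adHom_iterate_mem_self hx a (j + k))) N) ?_
    have h2 : ∀ n, ∑ p ∈ antidiagonal n, (((p.1 + 1).factorial : ℚ)⁻¹ *
        (bernoulli p.2 / (p.2.factorial : ℚ))) • (adHom x)^[p.1 + p.2] a =
        if n = 0 then a else 0 := fun n => by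
      rw [sum_congr rfl fun p hp => by rw [mem_antidiagonal.1 hp], ← sum_smul,
        sum_antidiagonal_bernoulli_div_factorial]
      split_ifs with h <;> simp [h]
    rw [sum_congr rfl fun n _ => h2 n]
    cases N with
    | zero => exact mem_piece_zero _
    | succ N => simp

/-- The identity `exp (R c) = 1 + R (a * exp (R c))` for the solution `c` of the zero
BCH-recursion. -/
theorem fexp_eq_one_add {R : A →ₗ[K] A} (hR : F.IsCompleteRotaBaxter (0 : K) R) {a c : A}
    (hc : F.IsZeroBCHSolution R a c) : F.fexp (R c) = 1 + R (a * F.fexp (R c)) := by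
  have hF := hR.isComplete
  have hx : R c ∈ F.piece 1 := hR.map_mem 1 c hc.1
  set x := R c
  have hac : F.HasSeriesSum (fun k => (((k + 1).factorial : ℚ)⁻¹) • (adHom x)^[k] c) a := by
    have h := hasSeriesSum_adIter hF hx a
    rwa [← hc.2] at h
  have hterm : ∀ k, (((k + 1).factorial : ℚ)⁻¹) • (adHom x)^[k] c ∈ F.piece k :=
    fun k => rat_smul_mem_piece _ (adHom_iterate_mem_self hx c k)
  -- The Cauchy product of the series for `a` and `exp x`, in terms of derivatives of powers.
  have hcoeff : ∀ n, ∑ p ∈ antidiagonal n, ((((p.1 + 1).factorial : ℚ)⁻¹) • (adHom x)^[p.1] c) *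
      (((p.2.factorial : ℚ)⁻¹) • x ^ p.2) =
      (((n + 1).factorial : ℚ)⁻¹) • powDeriv x c (n + 1) := fun n => by
    rw [powDeriv_eq_sum, smul_sum]
    refine sum_congr rfl fun p hp => ?_
    rw [smul_mul_smul_comm, ← Nat.cast_smul_eq_nsmul ℚ, smul_smul]
    congr 1
    have hp' : p.1 + 1 + p.2 = n + 1 := by rw [← mem_antidiagonal.1 hp]; omega
    rw [← hp', Nat.cast_add_choose]
    have := fun m : ℕ => (Nat.cast_ne_zero (R := ℚ)).2 m.factorial_ne_zero
    have h1 := this (p.1 + 1 + p.2)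
    field_simp
  have hprod := hac.mul (hasSeriesSum_fexp hF hx) hterm (expTerm_mem hx)
  simp only [hcoeff] at hprod
  have hpmem : ∀ n, (((n + 1).factorial : ℚ)⁻¹) • powDeriv x c (n + 1) ∈ F.piece n := fun n => by
    rw [← hcoeff]
    refine sum_mem fun p hp => ?_
    rw [← mem_antidiagonal.1 hp]
    exact F.mul_mem_piece _ _ _ (hterm _) _ (expTerm_mem hx _)
  refine eq_of_forall_sub_mem (F := F) fun N => ?_
  have h1 := F.piece_antitone N.le_succ
    ((hasSeriesSum_fexp hF hx).sub_mem (expTerm_mem hx) (N + 1))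
  have h2 := hR.map_mem N _ (hprod.sub_mem hpmem N)
  have h3 : R (∑ n ∈ range N, (((n + 1).factorial : ℚ)⁻¹) • powDeriv x c (n + 1)) =
      ∑ n ∈ range N, (((n + 1).factorial : ℚ)⁻¹) • x ^ (n + 1) := by
    rw [map_sum]
    refine sum_congr rfl fun n _ => ?_
    rw [map_rat_smul, hR.isRotaBaxter.map_powDeriv]
  rw [map_sub, h3] at h2
  rw [sum_range_succ'] at h1
  convert sub_mem h1 h2 using 1
  simp
  abel

end Rational

end AlgFiltration

open AlgFiltration in
theorem corollary3 {K A : Type*} [CommRing K] [Ring A] [Algebra K A] [Algebra ℚ A]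
    (F : AlgFiltration K A) (R : A →ₗ[K] A) (hR : F.IsCompleteRotaBaxter (0 : K) R)
    (a₀ a₁ : A) (ha₀ : a₀ ∈ F.piece 1) (ha₁ : a₁ ∈ F.piece 1) :
    (∀ a ∈ F.piece 1, ∃! c : A, F.IsZeroBCHSolution R a c) ∧
    (∀ b : A, b = R a₀ + R (a₁ * b) ↔
      b = F.fexp (R (F.zeroBCH R a₁)) * R (F.fexp (-R (F.zeroBCH R a₁)) * a₀)) ∧
    F.HasSeriesSum (fun n => (fun x : A => R (a₁ * x))^[n] (R a₀))
      (F.fexp (R (F.zeroBCH R a₁)) * R (F.fexp (-R (F.zeroBCH R a₁)) * a₀)) := by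
  have hF := hR.isComplete
  have hχ := isZeroBCHSolution_zeroBCH hF hR.map_mem ha₁
  have hE := fexp_eq_one_add hR hχ
  have hEE := fexp_mul_fexp_neg hF (hR.map_mem 1 _ hχ.1)
  set E := F.fexp (R (F.zeroBCH R a₁))
  set E' := F.fexp (-R (F.zeroBCH R a₁))
  -- The Rota-Baxter relation for `R (a₁ * E) * R (E' * a₀)`, where `R (a₁ * E) = E - 1`.
  have hsol : E * R (E' * a₀) = R a₀ + R (a₁ * (E * R (E' * a₀))) := by
    have h := hR.isRotaBaxter (a₁ * E) (E' * a₀)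
    rw [← sub_eq_iff_eq_add'.2 hE, zero_smul, add_zero, sub_mul, sub_mul, ← mul_assoc E E', hEE,
      map_sub, one_mul, one_mul, one_mul, mul_assoc a₁] at h
    rw [← sub_eq_iff_eq_add.2 h]
    abel
  have hcontr : ∀ b b' : A, ∀ n, b - b' ∈ F.piece n →
      R (a₁ * b) - R (a₁ * b') ∈ F.piece (n + 1) := fun b b' n h => by
    rw [← map_sub, ← mul_sub, add_comm]
    exact hR.map_mem _ _ (F.mul_mem_piece 1 n _ ha₁ _ h)
  refine ⟨fun a ha => existsUnique_isZeroBCHSolution hF hR.map_mem ha, fun b => ⟨fun hb => ?_, ?_⟩,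
    hasSeriesSum_of_sub_mem fun N => ?_⟩
  · refine eq_of_forall_sub_mem (F := F) fun n => ?_
    induction n with
    | zero => exact mem_piece_zero _
    | succ n ih =>
      rw [hb, hsol, add_sub_add_left_eq_sub]
      exact hcontr _ _ n ih
  · rintro rfl
    exact hsol
  · induction N with
    | zero => exact mem_piece_zero _
    | succ N ih =>
      have hsum : ∑ i ∈ range (N + 1), (fun x : A => R (a₁ * x))^[i] (R a₀) =
          R a₀ + R (a₁ * ∑ i ∈ range N, (fun x : A => R (a₁ * x))^[i] (R a₀)) := by
        rw [sum_range_succ', add_comm, mul_sum, map_sum]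
        simp only [Function.iterate_succ_apply', Function.iterate_zero_apply]
      rw [hsum, hsol, add_sub_add_left_eq_sub]
      exact hcontr _ _ N ih
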